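/- Let $d\ge 1$ and let $P\subset\mathbb R^d$ be a convex polytope, i.e. the convex hull of a finite set of points, with positive Lebesgue measure. Suppose that for some $1\le k\le d$ every vertex of $P$ has rational $k$-th coordinate and no edge of $P$ is contained in a hyperplane $\{x\in\mathbb R^d : x_k=c\}$, $c\in\mathbb R$. Then $P$ has an infinite set of orthogonal exponentials: there is an infinite countable set $\Lambda\subset\mathbb R^d$ such that $$\int_P e^{i\langle\lambda,x\rangle}\,\overline{e^{i\langle\lambda',x\rangle}}\,dx=0\qquad\text{for all }\lambda,\lambda'\in\Lambda,\ \lambda\ne\lambda'.$$ More precisely, write $F_Q(\omega)=\int_Q e^{-i\langle x,\omega\rangle}\,dx$ and let $e_k$ be the $k$-th standard unit vector. There is a positive integer $N$ such that $Nv_k\in\mathbb Z$ for every vertex $v$ of $P$, and for every such $N$: 1. $F_{NP}(2\pi\ell\, e_k)=0$ for every nonzero integer $\ell$, where $NP=\{Nx : x\in P\}$; equivalently, $F_P(2\pi N\ell\, e_k)=0$ for every nonzero integer $\ell$. 2. The rank-one lattice $\Lambda=\{2\pi N\ell\, e_k : \ell\in\mathbb Z\}$ on the $k$-th axis is infinite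 and $\{e^{i\langle\lambda,\cdot\rangle}\}_{\lambda\in\Lambda}$ is a set of orthogonal exponentials for $P$. -/

import Mathlib

open scoped Pointwise ComplexConjugate

/-- A convex polytope in `ℝᵈ`: the convex hull of finitely many points, of positive Lebesgue
measure. -/
def IsConvexPolytope {d : ℕ} (P : Set (EuclideanSpace ℝ (Fin d))) : Prop :=
  (∃ S : Finset (EuclideanSpace ℝ (Fin d)),
    P = convexHull ℝ (S : Set (EuclideanSpace ℝ (Fin d)))) ∧
  0 < MeasureTheory.volume P

/-- The vertices of `P` are its zero-dimensional faces, that is, its extreme points. -/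
def polytopeVertices {d : ℕ} (P : Set (EuclideanSpace ℝ (Fin d))) :
    Set (EuclideanSpace ℝ (Fin d)) :=
  Set.extremePoints ℝ P

/-- An edge of `P` is a one-dimensional face: a nondegenerate closed segment that is a face
(an extreme subset) of `P`. -/
def IsPolytopeEdge {d : ℕ} (P F : Set (EuclideanSpace ℝ (Fin d))) : Prop :=
  IsExtreme ℝ P F ∧ ∃ v w : EuclideanSpace ℝ (Fin d), v ≠ w ∧ F = segment ℝ v w

/-- The Fourier transform of the indicator function of `P`, normalised as
`F_P(ω) = ∫_P exp (-i⟨x, ω⟩) dx`. -/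
noncomputable def indicatorFourier {d : ℕ} (P : Set (EuclideanSpace ℝ (Fin d)))
    (ω : EuclideanSpace ℝ (Fin d)) : ℂ :=
  ∫ x in P, Complex.exp (-(Complex.I * ((inner ℝ x ω : ℝ) : ℂ)))

/-- `E(Λ) = {exp (i⟨l, ·⟩) : l ∈ Λ}` is a set of orthogonal exponentials for `D`: the frequency
set `Λ` is countable, and exponentials with distinct frequencies are orthogonal in `L²(D)`. -/
def IsOrthogonalExponentials {d : ℕ} (D Λ : Set (EuclideanSpace ℝ (Fin d))) : Prop :=
  Λ.Countable ∧ ∀ l ∈ Λ, ∀ l' ∈ Λ, l ≠ l' →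
    ∫ x in D, Complex.exp (Complex.I * ((inner ℝ l x : ℝ) : ℂ)) *
      conj (Complex.exp (Complex.I * ((inner ℝ l' x : ℝ) : ℂ))) = 0

/-- `N` is a common denominator of the `k`-th coordinates of the vertices of `P`. -/
def IsCommonDenominator {d : ℕ} (P : Set (EuclideanSpace ℝ (Fin d))) (k : Fin d) (N : ℕ) : Prop :=
  0 < N ∧ ∀ v ∈ polytopeVertices P, ∃ z : ℤ, (N : ℝ) * v k = (z : ℝ)

/-- The rank-one lattice `{ℓ a e_k : ℓ ∈ ℤ}` on the `k`-th coordinate axis. -/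
noncomputable def axisLattice {d : ℕ} (k : Fin d) (a : ℝ) : Set (EuclideanSpace ℝ (Fin d)) :=
  {x | ∃ l : ℤ, x = ((l : ℝ) * a) • EuclideanSpace.single k (1 : ℝ)}

/-! ### Exponential sums in one real variable -/

open MeasureTheory

/-! Let `h` be the `k`-th coordinate. The key claim (`scaledTransform_mem_expSpan`) is that, with no
edge in a level set of `h`, `ξ ^ d * F_P(ξ e_k)` is a constant-coefficient exponential sum whose
frequencies are heights of vertices. If `N` clears the denominators of these heights, `2πNℓ` is a
period of the sum. Its value there equals its value at `0`, which is `0` because of the factor `ξ ^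
d`; hence `F_P(2πNℓ e_k) = 0`, and orthogonality follows.

The claim is proved by induction on dimension. With the origin inside `P`, cut `P` into cones over
exposed faces. Radial integration turns a face's exponential sum `f` into `ξ ∫₀¹ f(sξ) ds`, again an
exponential sum, with the extra frequency `0`, provided `0` is not a frequency of `f`. This is
arranged by taking as apex an interior point `p` of generic height, at the cost of a spurious
frequency `h p`. A second apex of another height gives a second expansion, and linear independence
of exponentials eliminates the spurious term. -/

/-- The exponential `ξ ↦ exp (-i t ξ)` of frequency `t`. -/
noncomputable def expChar (t : ℝ) (ξ : ℝ) : ℂ := Complex.exp (-(Complex.I * ((t * ξ : ℝ) : ℂ)))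

theorem expChar_zero_right (t : ℝ) : expChar t 0 = 1 := by simp [expChar]

theorem expChar_add (s t ξ : ℝ) : expChar (s + t) ξ = expChar s ξ * expChar t ξ := by
  simp only [expChar, ← Complex.exp_add]
  congr 1; push_cast; ring

theorem continuous_expChar (t : ℝ) : Continuous (expChar t) := by
  unfold expChar; fun_prop

theorem hasDerivAt_expChar (t ξ : ℝ) :
    HasDerivAt (expChar t) (-(Complex.I * t) * expChar t ξ) ξ := by
  have h : HasDerivAt (fun x : ℝ => -(Complex.I * ((t * x : ℝ) : ℂ))) (-(Complex.I * t)) ξ := by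
    have := (((hasDerivAt_id ξ).const_mul t).ofReal_comp).const_mul (-Complex.I)
    simpa [neg_mul] using this
  exact h.cexp.congr_deriv (mul_comm _ _)

/-- Dedekind's independence of characters; the derivative at `0` separates frequencies. -/
theorem linearIndependent_expChar : LinearIndependent ℂ expChar := by
  let g : ℝ → (Multiplicative ℝ →* ℂ) := fun t =>
    { toFun := fun ξ => expChar t ξ.toAdd
      map_one' := by simp [expChar]
      map_mul' := fun x y => by
        simp only [expChar, ← Complex.exp_add, toAdd_mul]
        congr 1; push_cast; ring }
  have hg : Function.Injective g := by
    intro s t hst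
    have h1 : expChar s = expChar t := by
      ext ξ; exact DFunLike.congr_fun hst (Multiplicative.ofAdd ξ)
    have h2 := (hasDerivAt_expChar s 0).unique (h1 ▸ hasDerivAt_expChar t 0)
    simpa [expChar_zero_right] using h2
  exact (linearIndependent_monoidHom (Multiplicative ℝ) ℂ).comp g hg

/-- The exponential sums with frequencies in `A`. -/
noncomputable def expSpan (A : Set ℝ) : Submodule ℂ (ℝ → ℂ) := Submodule.span ℂ (expChar '' A)

theorem expSpan_mono {A B : Set ℝ} (h : A ⊆ B) : expSpan A ≤ expSpan B :=
  Submodule.span_mono (Set.image_mono h)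

theorem expChar_mem_expSpan {A : Set ℝ} {t : ℝ} (h : t ∈ A) : expChar t ∈ expSpan A :=
  Submodule.subset_span ⟨t, h, rfl⟩

/-- By linear independence the expansion is unique, so two bounds on the frequency set can be
intersected. This is what removes the height of the apex. -/
theorem mem_expSpan_inter {A B : Set ℝ} {f : ℝ → ℂ} (hA : f ∈ expSpan A) (hB : f ∈ expSpan B) :
    f ∈ expSpan (A ∩ B) := by
  unfold expSpan at *
  rw [Finsupp.mem_span_image_iff_linearCombination] at *
  obtain ⟨l, hl, rfl⟩ := hA
  obtain ⟨m, hm, h⟩ := hB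
  obtain rfl := linearIndependent_expChar h
  exact ⟨m, Set.subset_inter hl hm, rfl⟩

theorem expSpan_le_iff {A : Set ℝ} {M : Submodule ℂ (ℝ → ℂ)} :
    expSpan A ≤ M ↔ ∀ t ∈ A, expChar t ∈ M := by
  simp [expSpan, Submodule.span_le, Set.subset_def]

theorem continuous_of_mem_expSpan {A : Set ℝ} {f : ℝ → ℂ} (hf : f ∈ expSpan A) : Continuous f := by
  induction hf using Submodule.span_induction with
  | mem x h => obtain ⟨t, -, rfl⟩ := h; exact continuous_expChar t
  | zero => exact continuous_zero
  | add x y _ _ hx hy => exact hx.add hy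
  | smul c x _ hx => exact hx.const_smul c

theorem expChar_mul_mem_expSpan {A : Set ℝ} {f : ℝ → ℂ} (τ : ℝ) (hf : f ∈ expSpan A) :
    expChar τ * f ∈ expSpan ((τ + ·) '' A) := by
  have : expSpan A ≤ (expSpan ((τ + ·) '' A)).comap (LinearMap.mulLeft ℂ (expChar τ)) := by
    rw [expSpan_le_iff]
    intro t ht
    have : expChar τ * expChar t = expChar (τ + t) := by
      ext ξ; exact (expChar_add _ _ _).symm
    simpa [this] using expChar_mem_expSpan (Set.mem_image_of_mem (τ + ·) ht)
  exact this hf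

theorem mul_integral_expChar {t : ℝ} (ht : t ≠ 0) (ξ : ℝ) :
    (ξ : ℂ) * ∫ s in (0 : ℝ)..1, expChar t (s * ξ) =
      (Complex.I / t) * (expChar t ξ - expChar 0 ξ) := by
  have ht' : (t : ℂ) ≠ 0 := by exact_mod_cast ht
  have h : ∀ s ∈ Set.uIcc (0 : ℝ) 1, HasDerivAt (fun s => (Complex.I / t) * expChar t (s * ξ))
      (ξ * expChar t (s * ξ)) s := by
    intro s _
    have h1 := ((hasDerivAt_expChar t (s * ξ)).scomp s (hasDerivAt_mul_const ξ)).const_mul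
      (Complex.I / (t : ℂ))
    refine h1.congr_deriv ?_
    simp only [Complex.real_smul]
    field_simp
    rw [Complex.I_sq]; ring
  rw [← intervalIntegral.integral_const_mul, intervalIntegral.integral_eq_sub_of_hasDerivAt h]
  · simp [expChar]; ring
  · apply Continuous.intervalIntegrable
    exact continuous_const.mul ((continuous_expChar t).comp (continuous_id.mul continuous_const))

/-- Integrate termwise; the endpoint `s = 0` produces the frequency `0`. A frequency `0` in `A`
would instead produce the function `ξ`, which is not an exponential sum. -/
theorem mul_integral_mem_expSpan {A : Set ℝ} {f : ℝ → ℂ} (hA : 0 ∉ A) (hf : f ∈ expSpan A) :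
    (fun ξ : ℝ => (ξ : ℂ) * ∫ s in (0 : ℝ)..1, f (s * ξ)) ∈ expSpan (insert 0 A) := by
  have hint : ∀ g ∈ expSpan A, ∀ ξ : ℝ,
      IntervalIntegrable (fun s => g (s * ξ)) volume (0 : ℝ) 1 := fun g hg ξ =>
    ((continuous_of_mem_expSpan hg).comp (continuous_id.mul continuous_const)).intervalIntegrable _ _
  induction hf using Submodule.span_induction with
  | mem x h =>
    obtain ⟨t, ht, rfl⟩ := h
    have h0 : t ≠ 0 := by rintro rfl; exact hA ht
    have : (fun ξ : ℝ => (ξ : ℂ) * ∫ s in (0 : ℝ)..1, expChar t (s * ξ)) =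
        (Complex.I / t) • (expChar t - expChar 0) := by
      ext ξ; simpa using mul_integral_expChar h0 ξ
    rw [this]
    exact Submodule.smul_mem _ _ (Submodule.sub_mem _
      (expChar_mem_expSpan (Set.mem_insert_of_mem _ ht)) (expChar_mem_expSpan (Set.mem_insert _ _)))
  | zero =>
    simp only [Pi.zero_apply, intervalIntegral.integral_zero, mul_zero]
    exact Submodule.zero_mem _
  | add x y hx' hy' hx hy =>
    convert Submodule.add_mem _ hx hy using 1
    ext ξ
    simp only [Pi.add_apply]
    rw [intervalIntegral.integral_add (hint x hx' ξ) (hint y hy' ξ), mul_add]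
  | smul c x hx' hx =>
    convert Submodule.smul_mem _ c hx using 1
    ext ξ
    simp only [Pi.smul_apply, smul_eq_mul]
    rw [intervalIntegral.integral_const_mul]; ring

theorem expSpan_periodic {A : Set ℝ} {f : ℝ → ℂ} {N : ℝ} (hA : ∀ t ∈ A, ∃ z : ℤ, N * t = z)
    (hf : f ∈ expSpan A) (l : ℤ) : f (2 * Real.pi * N * l) = f 0 := by
  induction hf using Submodule.span_induction with
  | mem x h =>
    obtain ⟨t, ht, rfl⟩ := h
    obtain ⟨z, hz⟩ := hA t ht
    rw [expChar_zero_right, expChar, Complex.exp_eq_one_iff]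
    refine ⟨-(z * l), ?_⟩
    have : (N : ℂ) * t = z := by exact_mod_cast hz
    push_cast
    linear_combination (-Complex.I * 2 * Real.pi * l) * this
  | zero => rfl
  | add x y _ _ hx hy => simp [hx, hy]
  | smul c x _ hx => simp [hx]

/-! ### Integration over a cone with apex at the origin -/

section Cone
variable {V : Type*} [NormedAddCommGroup V] [NormedSpace ℝ V]

/-- The union of the segments joining the origin to the points of `G`. -/
def originCone (G : Set V) : Set V := (fun q : ℝ × V => q.1 • q.2) '' (Set.Icc 0 1 ×ˢ G)

theorem mem_originCone {G : Set V} {x : V} :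
    x ∈ originCone G ↔ ∃ s ∈ Set.Icc (0 : ℝ) 1, ∃ y ∈ G, s • y = x := by
  simp only [originCone, Set.mem_image, Set.mem_prod, Prod.exists]
  constructor
  · rintro ⟨s, y, ⟨hs, hy⟩, h⟩
    exact ⟨s, hs, y, hy, h⟩
  · rintro ⟨s, hs, y, hy, h⟩
    exact ⟨s, y, ⟨hs, hy⟩, h⟩

theorem IsCompact.originCone {G : Set V} (hG : IsCompact G) : IsCompact (originCone G) :=
  (isCompact_Icc.prod hG).image (by fun_prop)

/-- The splitting of a space along a vector on which a functional takes the value `1`. -/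
noncomputable def kerProdEquiv [FiniteDimensional ℝ V] (a : V →L[ℝ] ℝ) (y₀ : V) (ha : a y₀ = 1) :
    (LinearMap.ker (a : V →ₗ[ℝ] ℝ) × ℝ) ≃L[ℝ] V :=
  LinearEquiv.toContinuousLinearEquiv
    { toFun := fun q => (q.1 : V) + q.2 • y₀
      map_add' := fun p q => by simp [add_smul]; abel
      map_smul' := fun c p => by simp [mul_smul]
      invFun := fun x => (⟨x - a x • y₀, by simp [ha]⟩, a x)
      left_inv := fun q => by
        have : a (q.1 : V) = 0 := q.1.2
        ext <;> simp [this, ha]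
      right_inv := fun x => by simp }

theorem kerProdEquiv_apply [FiniteDimensional ℝ V] (a : V →L[ℝ] ℝ) (y₀ : V) (ha : a y₀ = 1)
    (q : LinearMap.ker (a : V →ₗ[ℝ] ℝ) × ℝ) : kerProdEquiv a y₀ ha q = (q.1 : V) + q.2 • y₀ := rfl

variable [FiniteDimensional ℝ V] [MeasurableSpace V] [BorelSpace V]

/-- Fubini along `a`: for `0 < s ≤ 1` the slice `a = s` of the cone is `s • G`, and rescaling it to
`G` yields the power of `s`. The constant comes from uniqueness of Haar measure, so it depends on
neither `G` nor `φ`. -/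
theorem exists_integral_originCone_eq (μ : Measure V) [μ.IsAddHaarMeasure] (a : V →L[ℝ] ℝ)
    (y₀ : V) (ha : a y₀ = 1) (ν : Measure (LinearMap.ker (a : V →ₗ[ℝ] ℝ))) [ν.IsAddHaarMeasure] :
    ∃ c : ℝ, ∀ (G : Set V) (_ : IsCompact G) (_ : ∀ y ∈ G, a y = 1) (φ : V → ℂ) (_ : Continuous φ),
      ∫ x in originCone G, φ x ∂μ = (c : ℂ) * ∫ s in (0 : ℝ)..1,
        (s : ℂ) ^ Module.finrank ℝ (LinearMap.ker (a : V →ₗ[ℝ] ℝ)) *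
          ∫ z in {z : LinearMap.ker (a : V →ₗ[ℝ] ℝ) | (z : V) + y₀ ∈ G},
            φ (s • ((z : V) + y₀)) ∂ν := by
  set L := kerProdEquiv a y₀ ha
  have : (Measure.map L (ν.prod volume)).IsAddHaarMeasure := L.isAddHaarMeasure_map _
  refine ⟨(μ.addHaarScalarFactor (Measure.map L (ν.prod volume)) : ℝ), fun G hG haG φ hφ => ?_⟩
  have hL : MeasurableEmbedding L := L.toHomeomorph.measurableEmbedding
  have hY := hG.originCone
  have hQ : MeasurableSet {z : LinearMap.ker (a : V →ₗ[ℝ] ℝ) | (z : V) + y₀ ∈ G} :=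
    (hG.isClosed.preimage (by fun_prop : Continuous
      fun z : LinearMap.ker (a : V →ₗ[ℝ] ℝ) => (z : V) + y₀)).measurableSet
  have hint : Integrable ((originCone G).indicator φ) (Measure.map L (ν.prod volume)) :=
    (integrable_indicator_iff hY.measurableSet).2 (hφ.continuousOn.integrableOn_compact hY)
  have haz : ∀ z : LinearMap.ker (a : V →ₗ[ℝ] ℝ), a (z : V) = 0 := fun z => z.2
  conv_lhs => rw [Measure.isAddLeftInvariant_eq_smul μ (Measure.map L (ν.prod volume))]
  rw [Measure.restrict_smul, integral_smul_nnreal_measure, NNReal.smul_def, Complex.real_smul]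
  congr 1
  rw [← integral_indicator hY.measurableSet,
    hL.integral_map, integral_prod_symm,
    intervalIntegral.integral_of_le zero_le_one, ← integral_indicator measurableSet_Ioc]
  swap
  · exact (hL.integrable_map_iff).1 hint
  refine integral_congr_ae ?_
  have h0 : ∀ᵐ s : ℝ, s ≠ 0 := by simp [ae_iff]
  filter_upwards [h0] with s hs
  by_cases hs1 : s ∈ Set.Ioc (0 : ℝ) 1
  · rw [Set.indicator_of_mem hs1]
    have h1 := Measure.integral_comp_smul ν (fun z => (originCone G).indicator φ (L (z, s))) s
    have hpos : (0 : ℝ) < s ^ Module.finrank ℝ (LinearMap.ker (a : V →ₗ[ℝ] ℝ)) := pow_pos hs1.1 _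
    have h2 : ∀ z, (originCone G).indicator φ (L (s • z, s)) =
        {z : LinearMap.ker (a : V →ₗ[ℝ] ℝ) | (z : V) + y₀ ∈ G}.indicator
          (fun z => φ (s • ((z : V) + y₀))) z := by
      intro z
      have hL : L (s • z, s) = s • ((z : V) + y₀) := by
        simp [L, kerProdEquiv_apply]
      rw [hL]
      have hiff : s • ((z : V) + y₀) ∈ originCone G ↔ (z : V) + y₀ ∈ G := by
        rw [mem_originCone]
        constructor
        · rintro ⟨t, -, y, hy, hty⟩
          have := congrArg a hty
          simp only [map_smul, map_add, haG y hy, haz, ha, smul_eq_mul, mul_one, zero_add] at this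
          subst this
          rwa [smul_right_injective V hs hty] at hy
        · intro h
          exact ⟨s, ⟨hs1.1.le, hs1.2⟩, _, h, rfl⟩
      by_cases hz : (z : V) + y₀ ∈ G
      · rw [Set.indicator_of_mem (hiff.2 hz), Set.indicator_of_mem (by exact hz)]
      · rw [Set.indicator_of_notMem (fun h => hz (hiff.1 h)), Set.indicator_of_notMem (by exact hz)]
    simp only [h2] at h1
    rw [integral_indicator hQ, abs_of_pos (inv_pos.2 hpos)] at h1
    rw [h1, Complex.real_smul, ← mul_assoc]
    push_cast
    rw [mul_inv_cancel₀ (by exact_mod_cast hpos.ne'), one_mul]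
  · rw [Set.indicator_of_notMem hs1]
    refine integral_eq_zero_of_ae (Filter.Eventually.of_forall fun z => ?_)
    refine Set.indicator_of_notMem (fun hmem => hs1 ?_) _
    obtain ⟨t, ht, y, hy, hty⟩ := mem_originCone.1 hmem
    have := congrArg a hty
    have hL : L (z, s) = (z : V) + s • y₀ := rfl
    rw [hL] at this
    simp only [map_smul, map_add, haG y hy, haz, ha, smul_eq_mul, mul_one, zero_add] at this
    subst this
    exact ⟨lt_of_le_of_ne ht.1 hs.symm, ht.2⟩

end Cone

/-! ### Exposed faces and the decomposition into cones -/

section Facets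
variable {V : Type*} [NormedAddCommGroup V] [NormedSpace ℝ V]

/-- `T` is the part of `S` on which the functional `a`, bounded by `1` on `S`, takes the
value `1`. -/
structure ExposesAtOne (S : Finset V) (a : V →L[ℝ] ℝ) (T : Finset V) : Prop where
  le_one : ∀ y ∈ S, a y ≤ 1
  mem_iff : ∀ y, y ∈ T ↔ y ∈ S ∧ a y = 1

variable {S T : Finset V} {a : V →L[ℝ] ℝ}

theorem ExposesAtOne.subset (h : ExposesAtOne S a T) : T ⊆ S := fun y hy => ((h.mem_iff y).1 hy).1

theorem ExposesAtOne.le_one_of_mem_convexHull (h : ExposesAtOne S a T) {y : V}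
    (hy : y ∈ convexHull ℝ (S : Set V)) : a y ≤ 1 :=
  convexHull_min (t := {y | a y ≤ 1}) (fun y hy => h.le_one y hy)
    (convex_halfSpace_le a.toLinearMap.isLinear 1) hy

theorem ExposesAtOne.eq_one_of_mem_convexHull (h : ExposesAtOne S a T) {y : V}
    (hy : y ∈ convexHull ℝ (T : Set V)) : a y = 1 :=
  convexHull_min (t := {y | a y = 1}) (fun y hy => ((h.mem_iff y).1 hy).2)
    (convex_hyperplane a.toLinearMap.isLinear 1) hy

/-- A convex combination of values at most `1` equals `1` only if all its weight sits where the
value is `1`. -/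
theorem ExposesAtOne.mem_convexHull_iff (h : ExposesAtOne S a T) {y : V} :
    y ∈ convexHull ℝ (T : Set V) ↔ y ∈ convexHull ℝ (S : Set V) ∧ a y = 1 := by
  refine ⟨fun hy => ⟨convexHull_mono (by exact_mod_cast h.subset) hy,
    h.eq_one_of_mem_convexHull hy⟩, fun ⟨hy, hay⟩ => ?_⟩
  obtain ⟨w, hw0, hw1, hwy⟩ := Finset.mem_convexHull'.1 hy
  have hsum : ∑ x ∈ S, w x * (1 - a x) = 0 := by
    have : a y = ∑ x ∈ S, w x * a x := by rw [← hwy]; simp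
    simp only [mul_sub, mul_one, Finset.sum_sub_distrib, hw1, ← this, hay, sub_self]
  have hzero := (Finset.sum_eq_zero_iff_of_nonneg fun x hx =>
    mul_nonneg (hw0 x hx) (sub_nonneg.2 (h.le_one x hx))).1 hsum
  have hwT : ∀ x ∈ S, x ∉ T → w x = 0 := by
    intro x hx hxT
    rcases mul_eq_zero.1 (hzero x hx) with h1 | h1
    · exact h1
    · exact absurd ((h.mem_iff x).2 ⟨hx, by linarith⟩) hxT
  refine Finset.mem_convexHull'.2 ⟨w, fun x hx => hw0 x (h.subset hx), ?_, ?_⟩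
  · rw [← hw1]; exact Finset.sum_subset h.subset hwT
  · rw [← hwy]
    exact Finset.sum_subset h.subset fun x hx hxT => by rw [hwT x hx hxT, zero_smul]

theorem ExposesAtOne.isExtreme (h : ExposesAtOne S a T) :
    IsExtreme ℝ (convexHull ℝ (S : Set V)) (convexHull ℝ (T : Set V)) := by
  refine ⟨convexHull_mono (by exact_mod_cast h.subset), fun x hx y hy z hz hzxy => ?_⟩
  rw [h.mem_convexHull_iff]
  refine ⟨hx, ?_⟩
  obtain ⟨s, t, hs, ht, hst, rfl⟩ := hzxy
  have h1 := h.eq_one_of_mem_convexHull hz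
  simp only [map_add, map_smul, smul_eq_mul] at h1
  have hx1 := h.le_one_of_mem_convexHull hx
  have hy1 := h.le_one_of_mem_convexHull hy
  by_contra hne
  have : a x < 1 := lt_of_le_of_ne hx1 hne
  nlinarith

/-- Here `r` is the gauge of `x`, so `r⁻¹ • x` is a boundary point. A supporting functional there is
positive because the origin is interior, and can be normalised to the value `1`. -/
theorem exists_exposesAtOne (h0 : (0 : V) ∈ interior (convexHull ℝ (S : Set V))) {x : V}
    (hx : x ≠ 0) : ∃ a T, ExposesAtOne S a T ∧ ∃ r : ℝ, 0 < r ∧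
      (x ∈ convexHull ℝ (S : Set V) → r ≤ 1) ∧ ∃ y ∈ convexHull ℝ (T : Set V), r • y = x := by
  classical
  set P := convexHull ℝ (S : Set V)
  have hconv : Convex ℝ P := convex_convexHull ℝ _
  have hcomp : IsCompact P := S.finite_toSet.isCompact_convexHull ℝ
  have hnhds : P ∈ nhds (0 : V) := mem_interior_iff_mem_nhds.1 h0
  have hr : 0 < gauge P x := (gauge_pos (absorbent_nhds_zero hnhds)
    (NormedSpace.isVonNBounded_of_isBounded ℝ hcomp.isBounded)).2 hx
  set r := gauge P x
  have hy1 : gauge P (r⁻¹ • x) = 1 := by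
    rw [gauge_smul_of_nonneg (inv_pos.2 hr).le, smul_eq_mul, inv_mul_cancel₀ hr.ne']
  have hfr := (gauge_eq_one_iff_mem_frontier hconv hnhds).1 hy1
  have hyP : r⁻¹ • x ∈ P := by
    have := hfr.1
    rwa [hcomp.isClosed.closure_eq] at this
  obtain ⟨f, hf⟩ := geometric_hahn_banach_open_point hconv.interior isOpen_interior hfr.2
  have hfpos : 0 < f (r⁻¹ • x) := by simpa using hf 0 h0
  set b := f (r⁻¹ • x)
  have hle : ∀ z ∈ P, f z ≤ b := by
    intro z hz
    have hsub : closure (interior P) ⊆ {z | f z ≤ b} :=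
      closure_minimal (fun z hz => (hf z hz).le) (isClosed_le f.continuous continuous_const)
    rw [hconv.closure_interior_eq_closure_of_nonempty_interior ⟨0, h0⟩] at hsub
    exact hsub (subset_closure hz)
  have hexp : ExposesAtOne S (b⁻¹ • f) (S.filter fun y => (b⁻¹ • f) y = 1) :=
    ⟨fun y hy => by
      have := hle y (subset_convexHull ℝ _ hy)
      simp only [smul_apply, smul_eq_mul]
      rw [inv_mul_le_iff₀ hfpos, mul_one]
      exact this, fun y => by simp⟩
  refine ⟨_, _, hexp, r, hr, fun hxP => gauge_le_one_of_mem hxP, r⁻¹ • x, ?_, ?_⟩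
  · rw [hexp.mem_convexHull_iff]
    exact ⟨hyP, inv_mul_cancel₀ hfpos.ne'⟩
  · rw [smul_inv_smul₀ hr.ne']

variable [FiniteDimensional ℝ V] [MeasurableSpace V] [BorelSpace V] (μ : Measure V) [μ.IsAddHaarMeasure]

theorem ExposesAtOne.aedisjoint {T' : Finset V} {a' : V →L[ℝ] ℝ} (h : ExposesAtOne S a T)
    (h' : ExposesAtOne S a' T') (hne : T ≠ T') :
    AEDisjoint μ (originCone (convexHull ℝ (T : Set V))) (originCone (convexHull ℝ (T' : Set V))) := by
  have haa : a - a' ≠ 0 := by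
    intro h0
    obtain rfl := sub_eq_zero.1 h0
    exact hne (Finset.ext fun y => (h.mem_iff y).trans (h'.mem_iff y).symm)
  have hker : LinearMap.ker ((a - a' : V →L[ℝ] ℝ) : V →ₗ[ℝ] ℝ) ≠ ⊤ := by
    intro htop
    exact haa (ContinuousLinearMap.coe_injective (LinearMap.ker_eq_top.1 htop))
  refine measure_mono_null ?_ (Measure.addHaar_submodule μ _ hker)
  rintro x ⟨hx, hx'⟩
  obtain ⟨s, hs, y, hy, rfl⟩ := mem_originCone.1 hx
  obtain ⟨s', hs', y', hy', hxy⟩ := mem_originCone.1 hx'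
  have h1 := congrArg a hxy
  have h2 := congrArg a' hxy
  simp only [map_smul, smul_eq_mul, h.eq_one_of_mem_convexHull hy,
    h'.eq_one_of_mem_convexHull hy'] at h1 h2
  have h3 := h.le_one_of_mem_convexHull (h'.mem_convexHull_iff.1 hy').1
  have h4 := h'.le_one_of_mem_convexHull (h.mem_convexHull_iff.1 hy).1
  -- `s = s' * a y' ≤ s'` and `s' = s * a' y ≤ s`; thus `a` and `a'` agree at the common point,
  -- which lies in the null hyperplane `ker (a - a')`.
  have h5 : s = s' := by nlinarith [hs.1, hs'.1]
  simp only [SetLike.mem_coe, LinearMap.mem_ker, ContinuousLinearMap.coe_coe,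
    sub_apply, map_smul, smul_eq_mul, h.eq_one_of_mem_convexHull hy]
  linarith

theorem exists_integral_eq_sum_originCone [Nontrivial V]
    (h0 : (0 : V) ∈ interior (convexHull ℝ (S : Set V))) :
    ∃ J : Finset (Finset V), (∀ T ∈ J, T.Nonempty ∧ ∃ a, ExposesAtOne S a T) ∧
      ∀ φ : V → ℂ, Continuous φ → ∫ x in convexHull ℝ (S : Set V), φ x ∂μ =
        ∑ T ∈ J, ∫ x in originCone (convexHull ℝ (T : Set V)), φ x ∂μ := by
  classical
  set J := S.powerset.filter fun T => T.Nonempty ∧ ∃ a, ExposesAtOne S a T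
  have hJ : ∀ T ∈ J, T.Nonempty ∧ ∃ a, ExposesAtOne S a T := fun T hT => (Finset.mem_filter.1 hT).2
  have hmemJ : ∀ x : V, x ≠ 0 → ∃ T ∈ J, ∃ r : ℝ, 0 < r ∧
      (x ∈ convexHull ℝ (S : Set V) → r ≤ 1) ∧ ∃ y ∈ convexHull ℝ (T : Set V), r • y = x := by
    intro x hx
    obtain ⟨a, T, haT, r, hr, hr1, y, hy, hyx⟩ := exists_exposesAtOne h0 hx
    refine ⟨T, Finset.mem_filter.2 ⟨Finset.mem_powerset.2 haT.subset, ?_, a, haT⟩,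
      r, hr, hr1, y, hy, hyx⟩
    exact Finset.coe_nonempty.1 (convexHull_nonempty_iff.1 ⟨y, hy⟩)
  refine ⟨J, hJ, fun φ hφ => ?_⟩
  have hcompT : ∀ T : Finset V, IsCompact (originCone (convexHull ℝ (T : Set V))) := fun T =>
    (T.finite_toSet.isCompact_convexHull ℝ).originCone
  have hunion : convexHull ℝ (S : Set V) =
      ⋃ T : J, originCone (convexHull ℝ ((T : Finset V) : Set V)) := by
    apply Set.Subset.antisymm
    · intro x hx
      rw [Set.mem_iUnion]
      rcases eq_or_ne x 0 with rfl | hx0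
      -- The apex lies in every nonempty cone; nontriviality of `V` supplies at least one.
      · obtain ⟨x, hx⟩ := exists_ne (0 : V)
        obtain ⟨T, hT, r, -, -, y, hy, -⟩ := hmemJ x hx
        exact ⟨⟨T, hT⟩, mem_originCone.2 ⟨0, ⟨le_rfl, zero_le_one⟩, y, hy, zero_smul _ _⟩⟩
      · obtain ⟨T, hT, r, hr, hr1, y, hy, hyx⟩ := hmemJ x hx0
        exact ⟨⟨T, hT⟩, mem_originCone.2 ⟨r, ⟨hr.le, hr1 hx⟩, y, hy, hyx⟩⟩
    · refine Set.iUnion_subset fun T x hx => ?_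
      obtain ⟨s, hs, y, hy, rfl⟩ := mem_originCone.1 hx
      obtain ⟨-, a, ha⟩ := hJ T T.2
      exact (convex_convexHull ℝ _).smul_mem_of_zero_mem (interior_subset h0)
        (ha.mem_convexHull_iff.1 hy).1 hs
  conv_lhs => rw [hunion]
  rw [integral_iUnion_ae (ι := J)
    (s := fun T => originCone (convexHull ℝ ((T : Finset V) : Set V))) (fun T => (hcompT T).measurableSet.nullMeasurableSet), tsum_fintype,
    ← Finset.sum_coe_sort J]
  · intro T T' hTT'
    obtain ⟨-, a, ha⟩ := hJ T T.2
    obtain ⟨-, a', ha'⟩ := hJ T' T'.2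
    exact ha.aedisjoint μ ha' fun h => hTT' (Subtype.ext h)
  · rw [← hunion]
    exact hφ.continuousOn.integrableOn_compact (S.finite_toSet.isCompact_convexHull ℝ)

end Facets

/-! ### Passing the edge condition to faces -/

section Edges
variable {V W : Type*} [NormedAddCommGroup V] [NormedSpace ℝ V] [NormedAddCommGroup W]
  [NormedSpace ℝ W]

theorem IsExtreme.image_affineMap {f : W →ᵃ[ℝ] V} (hf : Function.Injective f) {A B : Set W}
    (h : IsExtreme ℝ A B) : IsExtreme ℝ (f '' A) (f '' B) := by
  refine ⟨Set.image_mono h.subset, ?_⟩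
  rintro _ ⟨x, hx, rfl⟩ _ ⟨y, hy, rfl⟩ _ ⟨z, hz, rfl⟩ hxy
  rw [← image_openSegment, hf.mem_set_image] at hxy
  exact ⟨x, h.left_mem_of_mem_openSegment hx hy hz hxy, rfl⟩

/-- No nondegenerate segment that is a face of `P` lies in a level set of `h`. -/
def NoFlatEdge (h : V →L[ℝ] ℝ) (P : Set V) : Prop :=
  ∀ v w, v ≠ w → IsExtreme ℝ P (segment ℝ v w) → h v ≠ h w

theorem NoFlatEdge.of_affineMap {h : V →L[ℝ] ℝ} {P : Set V} (hP : NoFlatEdge h P)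
    {f : W →ᵃ[ℝ] V} (hf : Function.Injective f) {A : Set W} (hA : IsExtreme ℝ P (f '' A))
    {k : W →L[ℝ] ℝ} (hk : ∀ v w, k v = k w → h (f v) = h (f w)) : NoFlatEdge k A := by
  intro v w hvw hext hkvw
  have h1 := hext.image_affineMap hf
  rw [image_segment] at h1
  exact hP _ _ (hf.ne hvw) (hA.trans h1) (hk v w hkvw)

theorem preimage_convexHull_of_image_eq {f : W →ᵃ[ℝ] V} (hf : Function.Injective f)
    {A : Set W} {B : Set V} (h : f '' A = B) : f ⁻¹' convexHull ℝ B = convexHull ℝ A := by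
  rw [← h, ← AffineMap.image_convexHull, hf.preimage_image]

/-- Translating by `-y₀` moves the face into `ker a`. Edges of a face are edges of the polytope, so
the edge condition is inherited. -/
theorem ExposesAtOne.exists_facet {S T : Finset V} {a : V →L[ℝ] ℝ} (haT : ExposesAtOne S a T)
    {y₀ : V} (hy₀ : y₀ ∈ T) {h : V →L[ℝ] ℝ} (hS : NoFlatEdge h (convexHull ℝ (S : Set V))) :
    ∃ T' : Finset (LinearMap.ker (a : V →ₗ[ℝ] ℝ)),
      {z : LinearMap.ker (a : V →ₗ[ℝ] ℝ) | (z : V) + y₀ ∈ convexHull ℝ (T : Set V)} =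
        convexHull ℝ (T' : Set (LinearMap.ker (a : V →ₗ[ℝ] ℝ))) ∧
      NoFlatEdge (h.comp (LinearMap.ker (a : V →ₗ[ℝ] ℝ)).subtypeL)
        (convexHull ℝ (T' : Set (LinearMap.ker (a : V →ₗ[ℝ] ℝ)))) ∧
      ∀ z ∈ T', (z : V) + y₀ ∈ T := by
  classical
  let f : LinearMap.ker (a : V →ₗ[ℝ] ℝ) →ᵃ[ℝ] V :=
    (LinearMap.ker (a : V →ₗ[ℝ] ℝ)).subtype.toAffineMap + AffineMap.const ℝ _ y₀
  have hfz : ∀ z, f z = (z : V) + y₀ := fun z => rfl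
  have hf : Function.Injective f := fun z w hzw => by
    rw [hfz, hfz] at hzw
    exact Subtype.ext (add_right_cancel hzw)
  have hT' : f '' (T.preimage f hf.injOn : Set _) = T := by
    rw [Finset.coe_preimage, Set.image_preimage_eq_iff]
    intro y hy
    have h1 := ((haT.mem_iff y).1 hy).2
    have h2 := ((haT.mem_iff y₀).1 hy₀).2
    exact ⟨⟨y - y₀, by simp [h1, h2]⟩, by simp [hfz]⟩
  refine ⟨T.preimage f hf.injOn, ?_, ?_, fun z hz => ?_⟩
  · exact preimage_convexHull_of_image_eq hf hT'
  · refine hS.of_affineMap hf ?_ ?_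
    · rw [AffineMap.image_convexHull, hT']
      exact haT.isExtreme
    · intro v w hvw
      have : h (v : V) = h (w : V) := hvw
      rw [hfz, hfz, map_add, map_add, this]
  · exact (Finset.mem_preimage (f := f)).1 hz

/-- In dimension one the polytope is itself an edge. -/
theorem NoFlatEdge.ne_zero_of_finrank_eq_one [FiniteDimensional ℝ V] {h : V →L[ℝ] ℝ}
    {S : Finset V} (hS : NoFlatEdge h (convexHull ℝ (S : Set V)))
    (hint : (interior (convexHull ℝ (S : Set V))).Nonempty) (hV : Module.finrank ℝ V = 1) :
    h ≠ 0 := by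
  rintro rfl
  have : Nontrivial V := Module.nontrivial_of_finrank_pos (R := ℝ) (by omega)
  let a : V ≃ₗ[ℝ] ℝ := LinearEquiv.ofFinrankEq V ℝ (by simp [hV])
  have hne : S.Nonempty := Finset.coe_nonempty.1
    (convexHull_nonempty_iff.1 (hint.mono interior_subset))
  obtain ⟨v, hv, hvmin⟩ := S.exists_min_image a hne
  obtain ⟨w, hw, hwmax⟩ := S.exists_max_image a hne
  have hsub : (S : Set V) ⊆ segment ℝ v w := by
    intro x hx
    have h1 : a x ∈ segment ℝ (a v) (a w) := by
      rw [segment_eq_Icc (hvmin w hw)]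
      exact ⟨hvmin x hx, hwmax x hx⟩
    have h2 := image_segment ℝ a.toLinearMap.toAffineMap v w
    have h3 : a x ∈ a '' segment ℝ v w := by
      rw [show (a '' segment ℝ v w) = segment ℝ (a v) (a w) from h2]
      exact h1
    exact a.injective.mem_set_image.1 h3
  have heq : convexHull ℝ (S : Set V) = segment ℝ v w :=
    (convexHull_min hsub (convex_segment v w)).antisymm
      (segment_subset_convexHull hv hw)
  have hvw : v ≠ w := by
    rintro rfl
    rw [heq, segment_same, interior_singleton] at hint
    exact Set.not_nonempty_empty hint
  exact hS v w hvw (heq ▸ IsExtreme.refl ℝ _) rfl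

end Edges

/-! ### The inductive step with the origin in the interior -/

section Transform
variable {V : Type*} [NormedAddCommGroup V] [NormedSpace ℝ V]

theorem continuous_expChar_comp (h : V →L[ℝ] ℝ) (ξ : ℝ) : Continuous fun x => expChar (h x) ξ := by
  unfold expChar; fun_prop

variable [FiniteDimensional ℝ V]

theorem finrank_eq_finrank_ker_add_one (a : V →L[ℝ] ℝ) (y₀ : V) (ha : a y₀ = 1) :
    Module.finrank ℝ V = Module.finrank ℝ (LinearMap.ker (a : V →ₗ[ℝ] ℝ)) + 1 := by
  rw [← (kerProdEquiv a y₀ ha).toLinearEquiv.finrank_eq]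
  simp

variable [MeasurableSpace V] [BorelSpace V]

/-- The Fourier transform of the push-forward under `h` of the measure `μ` on `P`, multiplied by
the power of the frequency with exponent the dimension of the space. -/
noncomputable def scaledTransform (μ : Measure V) (h : V →L[ℝ] ℝ) (P : Set V) (ξ : ℝ) : ℂ :=
  (ξ : ℂ) ^ Module.finrank ℝ V * ∫ x in P, expChar (h x) ξ ∂μ

/-- The transforms of all polytopes without flat edges in hyperplanes through the origin are
exponential sums with frequencies the heights of the spanning points. -/
def KernelTransformsMem (h : V →L[ℝ] ℝ) : Prop :=
  ∀ a : V →L[ℝ] ℝ, a ≠ 0 → ∀ T : Finset (LinearMap.ker (a : V →ₗ[ℝ] ℝ)),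
    NoFlatEdge (h.comp (LinearMap.ker (a : V →ₗ[ℝ] ℝ)).subtypeL)
      (convexHull ℝ (T : Set (LinearMap.ker (a : V →ₗ[ℝ] ℝ)))) →
    scaledTransform Measure.addHaar (h.comp (LinearMap.ker (a : V →ₗ[ℝ] ℝ)).subtypeL)
        (convexHull ℝ (T : Set (LinearMap.ker (a : V →ₗ[ℝ] ℝ)))) ∈
      expSpan ((fun z : LinearMap.ker (a : V →ₗ[ℝ] ℝ) => h z) '' T)

variable {S T : Finset V} {a h : V →L[ℝ] ℝ} (μ : Measure V) [μ.IsAddHaarMeasure]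

theorem scaledTransform_originCone_mem (haT : ExposesAtOne S a T) (hT : T.Nonempty)
    (hK : KernelTransformsMem h) (hS : NoFlatEdge h (convexHull ℝ (S : Set V)))
    (h0 : 0 ∉ h '' (T : Set V)) :
    scaledTransform μ h (originCone (convexHull ℝ (T : Set V))) ∈
      expSpan (insert 0 (h '' (T : Set V))) := by
  obtain ⟨y₀, hy₀⟩ := hT
  have hay₀ := ((haT.mem_iff y₀).1 hy₀).2
  have ha0 : a ≠ 0 := by rintro rfl; simp at hay₀
  obtain ⟨T', hT', hflat, hmem⟩ := haT.exists_facet hy₀ hS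
  have hG := expChar_mul_mem_expSpan (h y₀) (hK a ha0 T' hflat)
  obtain ⟨c, hc⟩ := exists_integral_originCone_eq μ a y₀ hay₀ Measure.addHaar
  set G := scaledTransform Measure.addHaar (h.comp (LinearMap.ker (a : V →ₗ[ℝ] ℝ)).subtypeL)
        (convexHull ℝ (T' : Set (LinearMap.ker (a : V →ₗ[ℝ] ℝ))))
  have hsub : (h y₀ + ·) '' ((fun z : LinearMap.ker (a : V →ₗ[ℝ] ℝ) => h z) '' (T' : Set (LinearMap.ker (a : V →ₗ[ℝ] ℝ)))) ⊆
      h '' (T : Set V) := by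
    rintro _ ⟨_, ⟨z, hz, rfl⟩, rfl⟩
    exact ⟨(z : V) + y₀, hmem z hz, by simp [add_comm]⟩
  have hcone := mul_integral_mem_expSpan h0 (expSpan_mono hsub hG)
  convert Submodule.smul_mem _ (c : ℂ) hcone using 1
  ext ξ
  have h1 := hc (convexHull ℝ (T : Set V)) (T.finite_toSet.isCompact_convexHull ℝ)
    (fun y hy => haT.eq_one_of_mem_convexHull hy) (fun x => expChar (h x) ξ)
    (continuous_expChar_comp h ξ)
  rw [hT'] at h1
  simp only [Pi.smul_apply, smul_eq_mul]
  -- One factor `ξ` is kept for the radial integral; the others join the Jacobian as `(s * ξ) ^ (n -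
  -- 1)`, the scaling of the face's transform at `s * ξ`.
  rw [scaledTransform, h1, finrank_eq_finrank_ker_add_one a y₀ hay₀, mul_left_comm, pow_succ',
    mul_assoc]
  refine congrArg (fun w => (c : ℂ) * ((ξ : ℂ) * w)) ?_
  rw [← intervalIntegral.integral_const_mul]
  refine intervalIntegral.integral_congr fun s _ => ?_
  simp only [Pi.mul_apply, G, scaledTransform]
  have h2 : ∀ z : LinearMap.ker (a : V →ₗ[ℝ] ℝ), expChar (h (s • ((z : V) + y₀))) ξ =
      expChar (h y₀) (s * ξ) * expChar (h z) (s * ξ) := by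
    intro z
    rw [← expChar_add]
    simp only [expChar, map_smul, map_add, smul_eq_mul]
    congr 4; ring
  simp only [h2, integral_const_mul]
  push_cast
  rw [mul_pow]
  simp only [Function.comp_apply, Submodule.subtypeL_apply]
  ring

theorem scaledTransform_mem_of_zero_mem_interior [Nontrivial V] (hK : KernelTransformsMem h)
    (hS : NoFlatEdge h (convexHull ℝ (S : Set V)))
    (hint : (0 : V) ∈ interior (convexHull ℝ (S : Set V))) (h0 : 0 ∉ h '' (S : Set V)) :
    scaledTransform μ h (convexHull ℝ (S : Set V)) ∈ expSpan (insert 0 (h '' (S : Set V))) := by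
  obtain ⟨J, hJ, hsum⟩ := exists_integral_eq_sum_originCone μ hint
  have : scaledTransform μ h (convexHull ℝ (S : Set V)) =
      ∑ T ∈ J, scaledTransform μ h (originCone (convexHull ℝ (T : Set V))) := by
    ext ξ
    rw [Finset.sum_apply]
    simp only [scaledTransform]
    rw [hsum _ (continuous_expChar_comp h ξ), Finset.mul_sum]
  rw [this]
  refine Submodule.sum_mem _ fun T hT => ?_
  obtain ⟨hne, a, ha⟩ := hJ T hT
  have hsub : h '' (T : Set V) ⊆ h '' (S : Set V) := Set.image_mono (by exact_mod_cast ha.subset)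
  exact expSpan_mono (Set.insert_subset_insert hsub)
    (scaledTransform_originCone_mem μ ha hne hK hS fun h1 => h0 (hsub h1))

theorem eq_const_of_mem_expSpan_zero {A : Set ℝ} (hA : A ⊆ {0}) {f : ℝ → ℂ} (hf : f ∈ expSpan A)
    (ξ : ℝ) : f ξ = f 0 := by
  have : expSpan A ≤ LinearMap.ker ((LinearMap.proj ξ : (ℝ → ℂ) →ₗ[ℂ] ℂ) - (LinearMap.proj 0 : (ℝ → ℂ) →ₗ[ℂ] ℂ)) := by
    rw [expSpan_le_iff]
    intro t ht
    obtain rfl := hA ht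
    simp [expChar]
  simpa [sub_eq_zero] using this hf

/-- If `h = 0`, each face's transform is its volume times a positive power of `ξ`, yet also constant
by `hK`. So all faces have volume zero, and then so has the polytope. -/
theorem ne_zero_of_zero_mem_interior (hV : 2 ≤ Module.finrank ℝ V) (hK : KernelTransformsMem h)
    (hS : NoFlatEdge h (convexHull ℝ (S : Set V)))
    (hint : (0 : V) ∈ interior (convexHull ℝ (S : Set V))) : h ≠ 0 := by
  rintro rfl
  have : Nontrivial V := Module.nontrivial_of_finrank_pos (R := ℝ) (by omega)
  let μ : Measure V := Measure.addHaar
  obtain ⟨J, hJ, hsum⟩ := exists_integral_eq_sum_originCone μ hint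
  have hpos : 0 < μ.real (convexHull ℝ (S : Set V)) :=
    ENNReal.toReal_pos
      (Measure.measure_pos_of_mem_nhds μ (mem_interior_iff_mem_nhds.1 hint)).ne'
      (S.finite_toSet.isCompact_convexHull ℝ).measure_lt_top.ne
  have h1 := hsum (fun _ => 1) continuous_const
  rw [Finset.sum_eq_zero] at h1
  · simp [hpos.ne'] at h1
  intro T hT
  obtain ⟨⟨y₀, hy₀⟩, a, haT⟩ := hJ T hT
  have hay₀ := ((haT.mem_iff y₀).1 hy₀).2
  have ha0 : a ≠ 0 := by rintro rfl; simp at hay₀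
  obtain ⟨T', hT', hflat, -⟩ := haT.exists_facet hy₀ hS
  obtain ⟨c, hc⟩ := exists_integral_originCone_eq μ a y₀ hay₀ Measure.addHaar
  rw [hc (convexHull ℝ (T : Set V)) (T.finite_toSet.isCompact_convexHull ℝ)
    (fun y hy => haT.eq_one_of_mem_convexHull hy) _ continuous_const, hT']
  have h2 := eq_const_of_mem_expSpan_zero (by rintro _ ⟨z, -, rfl⟩; simp) (hK a ha0 T' hflat) 1
  have h3 := finrank_eq_finrank_ker_add_one a y₀ hay₀
  simp only [scaledTransform, expChar] at h2
  rw [Complex.ofReal_zero, zero_pow (by omega)] at h2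
  have h4 : ∫ z in convexHull ℝ (T' : Set (LinearMap.ker (a : V →ₗ[ℝ] ℝ))), (1 : ℂ)
      ∂Measure.addHaar = 0 := by simpa using h2
  simp only [h4, mul_zero, intervalIntegral.integral_zero]

end Transform

/-! ### Eliminating the apex and the induction on dimension -/

section Main

theorem exists_translate_convexHull {V : Type*} [NormedAddCommGroup V] [NormedSpace ℝ V]
    (S : Finset V) {h : V →L[ℝ] ℝ} (hS : NoFlatEdge h (convexHull ℝ (S : Set V))) (p : V) :
    ∃ S' : Finset V, (· + p) ⁻¹' convexHull ℝ (S : Set V) = convexHull ℝ (S' : Set V) ∧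
      (· + p) '' (S' : Set V) = S ∧ NoFlatEdge h (convexHull ℝ (S' : Set V)) := by
  classical
  let f : V →ᵃ[ℝ] V := LinearMap.id.toAffineMap + AffineMap.const ℝ V p
  have hfx : ∀ x, f x = x + p := fun x => rfl
  have hf : Function.Injective f := fun x y hxy => add_right_cancel hxy
  have himg : f '' (S.image (· - p) : Set V) = S := by
    simp only [Finset.coe_image, Set.image_image, hfx, sub_add_cancel, Set.image_id']
  refine ⟨S.image (· - p), preimage_convexHull_of_image_eq hf himg, himg,
    hS.of_affineMap hf ?_ ?_⟩
  · rw [AffineMap.image_convexHull, himg]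
  · intro v w hvw
    rw [hfx, hfx, map_add, map_add, hvw]

theorem zero_mem_interior_preimage_add {V : Type*} [NormedAddCommGroup V] {P : Set V} {p : V} (hp : p ∈ interior P) :
    (0 : V) ∈ interior ((· + p) ⁻¹' P) := by
  rw [mem_interior_iff_mem_nhds] at *
  exact (continuous_add_const p).continuousAt.preimage_mem_nhds (by simpa using hp)

variable {V : Type*} [NormedAddCommGroup V] [NormedSpace ℝ V] [FiniteDimensional ℝ V]
  [MeasurableSpace V] [BorelSpace V]

/-- Translating `p` to the origin multiplies the transform by a single exponential, and the apex
frequency `0` becomes `h p`. -/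
theorem scaledTransform_mem_of_mem_interior [Nontrivial V] (μ : Measure V) [μ.IsAddHaarMeasure]
    {h : V →L[ℝ] ℝ} (hK : KernelTransformsMem h) {S : Finset V}
    (hS : NoFlatEdge h (convexHull ℝ (S : Set V))) {p : V}
    (hp : p ∈ interior (convexHull ℝ (S : Set V))) (hhp : h p ∉ h '' (S : Set V)) :
    scaledTransform μ h (convexHull ℝ (S : Set V)) ∈ expSpan (insert (h p) (h '' (S : Set V))) := by
  obtain ⟨S', hpre, himg, hS'⟩ := exists_translate_convexHull S hS p
  have hint := zero_mem_interior_preimage_add hp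
  rw [hpre] at hint
  have himg' : (h p + ·) '' (h '' (S' : Set V)) = h '' (S : Set V) := by
    rw [← himg, Set.image_image, Set.image_image]
    exact Set.image_congr fun x _ => by rw [map_add, add_comm]
  have h0 : 0 ∉ h '' (S' : Set V) := by
    intro hmem
    exact hhp (himg' ▸ ⟨0, hmem, add_zero _⟩)
  have h1 := expChar_mul_mem_expSpan (h p)
    (scaledTransform_mem_of_zero_mem_interior μ hK hS' hint h0)
  rw [Set.image_insert_eq, himg', add_zero] at h1
  convert h1 using 1
  ext ξ
  simp only [Pi.mul_apply, scaledTransform]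
  rw [← hpre,
    ← (measurePreserving_add_right μ p).setIntegral_preimage_emb
      (MeasurableEquiv.addRight p).measurableEmbedding]
  simp only [map_add, expChar_add, integral_mul_const]
  ring

theorem scaledTransform_mem_of_kernelTransformsMem [Nontrivial V] (μ : Measure V)
    [μ.IsAddHaarMeasure] {h : V →L[ℝ] ℝ} (hK : KernelTransformsMem h) {S : Finset V}
    (hS : NoFlatEdge h (convexHull ℝ (S : Set V)))
    (hint : (interior (convexHull ℝ (S : Set V))).Nonempty) :
    scaledTransform μ h (convexHull ℝ (S : Set V)) ∈ expSpan (h '' (S : Set V)) := by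
  have hh : h ≠ 0 := by
    rcases (Nat.succ_le_of_lt (Module.finrank_pos (R := ℝ) (M := V))).eq_or_lt with h1 | h1
    · exact hS.ne_zero_of_finrank_eq_one hint h1.symm
    · obtain ⟨p, hp⟩ := hint
      obtain ⟨S', hpre, -, hS'⟩ := exists_translate_convexHull S hS p
      exact ne_zero_of_zero_mem_interior h1 hK hS' (hpre ▸ zero_mem_interior_preimage_add hp)
  have hsurj : Function.Surjective h := LinearMap.surjective_of_ne_zero (f := (h : V →ₗ[ℝ] ℝ))
    fun h0 => hh (ContinuousLinearMap.coe_injective h0)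
  have hopen : IsOpen (h '' interior (convexHull ℝ (S : Set V))) :=
    h.isOpenMap hsurj _ isOpen_interior
  have hinf : (h '' interior (convexHull ℝ (S : Set V))).Infinite := by
    obtain ⟨t, ht⟩ := hint.image h
    exact infinite_of_mem_nhds t (hopen.mem_nhds ht)
  have hfin : (h '' (S : Set V)).Finite := S.finite_toSet.image h
  -- Since `h ≠ 0`, the interior has infinitely many heights: choose two distinct ones that avoid
  -- the finitely many heights of `S`.
  obtain ⟨_, ⟨p, hp, rfl⟩, hpS⟩ := (hinf.sdiff hfin).nonempty
  obtain ⟨_, ⟨q, hq, rfl⟩, hqS⟩ := (hinf.sdiff (hfin.insert (h p))).nonempty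
  rw [Set.mem_insert_iff, not_or] at hqS
  refine expSpan_mono ?_ (mem_expSpan_inter (scaledTransform_mem_of_mem_interior μ hK hS hp hpS)
    (scaledTransform_mem_of_mem_interior μ hK hS hq hqS.2))
  rintro t ⟨rfl | ht, ht'⟩
  · exact ht'.resolve_left fun h1 => hqS.1 h1.symm
  · exact ht

theorem scaledTransform_mem_expSpan_aux (n : ℕ) : ∀ (V : Type*) [NormedAddCommGroup V]
    [NormedSpace ℝ V] [FiniteDimensional ℝ V] [MeasurableSpace V] [BorelSpace V] (μ : Measure V)
    [μ.IsAddHaarMeasure] (h : V →L[ℝ] ℝ) (S : Finset V), Module.finrank ℝ V = n →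
    NoFlatEdge h (convexHull ℝ (S : Set V)) →
    scaledTransform μ h (convexHull ℝ (S : Set V)) ∈ expSpan (h '' (S : Set V)) := by
  induction n with
  | zero =>
    intro V _ _ _ _ _ μ _ h S hV _
    have : Subsingleton V := Module.finrank_zero_iff.1 hV
    have hx : ∀ x : V, h x = 0 := fun x => by rw [Subsingleton.elim x 0, map_zero]
    rcases S.eq_empty_or_nonempty with rfl | ⟨v, hv⟩
    · convert Submodule.zero_mem _ using 1
      ext ξ; simp [scaledTransform]
    · have h0 : (0 : ℝ) ∈ h '' (S : Set V) := ⟨v, hv, hx v⟩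
      convert Submodule.smul_mem _ (μ.real (convexHull ℝ (S : Set V)) : ℂ)
        (expChar_mem_expSpan h0) using 1
      ext ξ; simp [scaledTransform, hx, hV]
  | succ n ih =>
    intro V _ _ _ _ _ μ _ h S hV hS
    have : Nontrivial V := Module.nontrivial_of_finrank_pos (R := ℝ) (by omega)
    rcases (interior (convexHull ℝ (S : Set V))).eq_empty_or_nonempty with hint | hint
    -- Lower-dimensional polytopes are null. This also disposes of exposed faces that are not
    -- facets.
    · have hnull : μ (convexHull ℝ (S : Set V)) = 0 := by
        refine measure_mono_null (fun x hx => ?_) ((convex_convexHull ℝ (S : Set V)).addHaar_frontier μ)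
        exact ⟨subset_closure hx, by simp [hint]⟩
      convert Submodule.zero_mem _ using 1
      ext ξ
      simp [scaledTransform, Measure.restrict_eq_zero.2 hnull]
    · refine scaledTransform_mem_of_kernelTransformsMem μ (fun a ha T hT => ?_) hS hint
      obtain ⟨y, hy⟩ : ∃ y, a y ≠ 0 := by
        by_contra! hall
        exact ha (ContinuousLinearMap.ext hall)
      have hfr := finrank_eq_finrank_ker_add_one a ((a y)⁻¹ • y) (by simp [hy])
      exact ih (LinearMap.ker (a : V →ₗ[ℝ] ℝ)) Measure.addHaar
        (h.comp (LinearMap.ker (a : V →ₗ[ℝ] ℝ)).subtypeL) T (by omega) hT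

/-- If no edge of a polytope lies in a level set of the linear functional `h`, then the Fourier
transform of the polytope along `h`, multiplied by the power of the frequency with exponent the
dimension, is an exponential sum whose frequencies are heights of points spanning the polytope. -/
theorem scaledTransform_mem_expSpan (μ : Measure V) [μ.IsAddHaarMeasure] (h : V →L[ℝ] ℝ)
    (S : Finset V) (hS : NoFlatEdge h (convexHull ℝ (S : Set V))) :
    scaledTransform μ h (convexHull ℝ (S : Set V)) ∈ expSpan (h '' (S : Set V)) :=
  scaledTransform_mem_expSpan_aux _ V μ h S rfl hS

end Main

/-! ### Vertices, zeros and orthogonality -/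

section Polytope
variable {d : ℕ} {P : Set (EuclideanSpace ℝ (Fin d))} {k : Fin d}

theorem IsConvexPolytope.finite_vertices (hP : IsConvexPolytope P) :
    (polytopeVertices P).Finite := by
  obtain ⟨⟨S, rfl⟩, -⟩ := hP
  exact S.finite_toSet.subset extremePoints_convexHull_subset

/-- Krein–Milman; the closure is superfluous because the vertices are finite in number. -/
theorem IsConvexPolytope.convexHull_vertices (hP : IsConvexPolytope P) :
    convexHull ℝ (polytopeVertices P) = P := by
  have hfin := hP.finite_vertices
  obtain ⟨⟨S, rfl⟩, -⟩ := hP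
  have := closure_convexHull_extremePoints (S.finite_toSet.isCompact_convexHull ℝ)
    (convex_convexHull ℝ (S : Set (EuclideanSpace ℝ (Fin d))))
  change closure (convexHull ℝ (polytopeVertices _)) = _ at this
  rwa [(hfin.isClosed_convexHull ℝ).closure_eq] at this

theorem exists_isCommonDenominator (hP : IsConvexPolytope P)
    (hrat : ∀ v ∈ polytopeVertices P, ∃ q : ℚ, v k = (q : ℝ)) :
    ∃ N : ℕ, IsCommonDenominator P k N := by
  classical
  choose! q hq using hrat
  refine ⟨∏ v ∈ hP.finite_vertices.toFinset, (q v).den,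
    Finset.prod_pos fun v _ => (q v).den_pos, fun v hv => ?_⟩
  obtain ⟨m, hm⟩ := Finset.dvd_prod_of_mem (fun v => (q v).den)
    (hP.finite_vertices.mem_toFinset.2 hv)
  refine ⟨m * (q v).num, ?_⟩
  rw [hq v hv, hm]
  have : ((q v : ℝ)) * (q v).den = (q v).num := by exact_mod_cast Rat.mul_den_eq_num (q v)
  push_cast
  linear_combination (m : ℝ) * this

theorem indicatorFourier_single (ξ : ℝ) :
    indicatorFourier P (ξ • EuclideanSpace.single k (1 : ℝ)) = ∫ x in P, expChar (x k) ξ := by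
  simp only [indicatorFourier, expChar, inner_smul_right, EuclideanSpace.inner_single_right]
  simp [mul_comm]

theorem indicatorFourier_eq_zero (hP : IsConvexPolytope P)
    (hedge : ∀ F : Set (EuclideanSpace ℝ (Fin d)), IsPolytopeEdge P F →
      ¬ ∃ c : ℝ, F ⊆ {x | x k = c}) {N : ℕ} (hN : IsCommonDenominator P k N) {l : ℤ} (hl : l ≠ 0) :
    indicatorFourier P ((2 * Real.pi * (N : ℝ) * (l : ℝ)) • EuclideanSpace.single k (1 : ℝ)) = 0 := by
  let h : EuclideanSpace ℝ (Fin d) →L[ℝ] ℝ := EuclideanSpace.proj k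
  have hhull : convexHull ℝ (hP.finite_vertices.toFinset : Set (EuclideanSpace ℝ (Fin d))) = P := by
    rw [Set.Finite.coe_toFinset, hP.convexHull_vertices]
  have hflat : NoFlatEdge h P := by
    intro v w hvw hext heq
    refine hedge _ ⟨hext, v, w, hvw, rfl⟩ ⟨v k, ?_⟩
    refine (convex_hyperplane (f := h) h.toLinearMap.isLinear (v k)).segment_subset rfl ?_
    exact heq.symm
  have hmem := scaledTransform_mem_expSpan volume h hP.finite_vertices.toFinset (hhull.symm ▸ hflat)
  rw [hhull, Set.Finite.coe_toFinset] at hmem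
  have hper := expSpan_periodic (N := N) (by
    rintro _ ⟨v, hv, rfl⟩
    exact hN.2 v hv) hmem l
  have hd : d ≠ 0 := by rintro rfl; exact k.elim0
  have hξ : (2 * Real.pi * (N : ℝ) * (l : ℝ)) ≠ 0 := by
    have := hN.1.ne'
    have := Real.pi_ne_zero
    positivity
  simp only [scaledTransform, finrank_euclideanSpace_fin] at hper
  -- The sum's value at frequency `0` vanishes because `d > 0`.
  rw [Complex.ofReal_zero, zero_pow hd, zero_mul] at hper
  rw [indicatorFourier_single]
  exact (mul_eq_zero.1 hper).resolve_left (pow_ne_zero _ (by exact_mod_cast hξ))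

theorem indicatorFourier_smul {c : ℝ} (hc : c ≠ 0) (ω : EuclideanSpace ℝ (Fin d)) :
    indicatorFourier (c • P) ω = |c ^ d| • indicatorFourier P (c • ω) := by
  have h1 := Measure.setIntegral_comp_smul volume
    (fun x : EuclideanSpace ℝ (Fin d) => Complex.exp (-(Complex.I * ((inner ℝ x ω : ℝ) : ℂ)))) P hc
  have hpos : |c ^ d| ≠ 0 := abs_ne_zero.2 (pow_ne_zero _ hc)
  simp only [finrank_euclideanSpace_fin, abs_inv] at h1
  rw [indicatorFourier, indicatorFourier, ← inv_smul_eq_iff₀ hpos, ← h1]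
  simp only [real_inner_smul_left, real_inner_smul_right]

theorem axisLattice_infinite {a : ℝ} (ha : a ≠ 0) : (axisLattice k a).Infinite := by
  have hinj : Function.Injective fun l : ℤ =>
      ((l : ℝ) * a) • (EuclideanSpace.single k (1 : ℝ) : EuclideanSpace ℝ (Fin d)) := by
    intro l m hlm
    have := congrArg (fun x : EuclideanSpace ℝ (Fin d) => x k) hlm
    simpa [ha] using this
  refine (Set.infinite_range_of_injective hinj).mono ?_
  rintro _ ⟨l, rfl⟩
  exact ⟨l, rfl⟩

theorem isOrthogonalExponentials_axisLattice {a : ℝ}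
    (h : ∀ l : ℤ, l ≠ 0 →
      indicatorFourier P ((a * (l : ℝ)) • EuclideanSpace.single k (1 : ℝ)) = 0) :
    IsOrthogonalExponentials P (axisLattice k a) := by
  constructor
  · refine (Set.countable_range fun l : ℤ =>
      ((l : ℝ) * a) • (EuclideanSpace.single k (1 : ℝ) : EuclideanSpace ℝ (Fin d))).mono ?_
    rintro _ ⟨l, rfl⟩
    exact ⟨l, rfl⟩
  · rintro _ ⟨l, rfl⟩ _ ⟨m, rfl⟩ hlm
    -- The order `m - l` matches the minus sign in the exponent of `indicatorFourier`.
    have hne : m - l ≠ 0 := fun h0 => hlm (by rw [sub_eq_zero.1 h0])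
    rw [← h _ hne, indicatorFourier]
    refine integral_congr_ae (Filter.Eventually.of_forall fun x => ?_)
    simp only
    rw [← Complex.exp_conj, ← Complex.exp_add]
    congr 1
    simp only [map_mul, Complex.conj_I, Complex.conj_ofReal,
      real_inner_smul_right, real_inner_comm x]
    push_cast
    ring

end Polytope

theorem theorem2p2 {d : ℕ} (P : Set (EuclideanSpace ℝ (Fin d))) (hP : IsConvexPolytope P)
    (k : Fin d)
    (hrat : ∀ v ∈ polytopeVertices P, ∃ q : ℚ, v k = (q : ℝ))
    (hedge : ∀ F : Set (EuclideanSpace ℝ (Fin d)), IsPolytopeEdge P F →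
      ¬ ∃ c : ℝ, F ⊆ {x | x k = c}) :
    (∃ Λ : Set (EuclideanSpace ℝ (Fin d)), Λ.Infinite ∧ IsOrthogonalExponentials P Λ) ∧
    (∃ N : ℕ, IsCommonDenominator P k N) ∧
    (∀ N : ℕ, IsCommonDenominator P k N →
      (∀ l : ℤ, l ≠ 0 →
        indicatorFourier ((N : ℝ) • P)
          ((2 * Real.pi * (l : ℝ)) • EuclideanSpace.single k (1 : ℝ)) = 0) ∧
      (∀ l : ℤ, l ≠ 0 →
        indicatorFourier P
          ((2 * Real.pi * (N : ℝ) * (l : ℝ)) • EuclideanSpace.single k (1 : ℝ)) = 0) ∧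
      (axisLattice k (2 * Real.pi * (N : ℝ))).Infinite ∧
      IsOrthogonalExponentials P (axisLattice k (2 * Real.pi * (N : ℝ)))) := by
  have hzero : ∀ N : ℕ, IsCommonDenominator P k N → ∀ l : ℤ, l ≠ 0 →
      indicatorFourier P
        ((2 * Real.pi * (N : ℝ) * (l : ℝ)) • EuclideanSpace.single k (1 : ℝ)) = 0 :=
    fun N hN l hl => indicatorFourier_eq_zero hP hedge hN hl
  have hinf : ∀ N : ℕ, IsCommonDenominator P k N →
      (axisLattice k (2 * Real.pi * (N : ℝ))).Infinite := fun N hN =>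
    axisLattice_infinite (mul_ne_zero Real.two_pi_pos.ne' (by exact_mod_cast hN.1.ne'))
  have horth : ∀ N : ℕ, IsCommonDenominator P k N →
      IsOrthogonalExponentials P (axisLattice k (2 * Real.pi * (N : ℝ))) := fun N hN =>
    isOrthogonalExponentials_axisLattice (hzero N hN)
  obtain ⟨N₀, hN₀⟩ := exists_isCommonDenominator hP hrat
  refine ⟨⟨_, hinf N₀ hN₀, horth N₀ hN₀⟩, ⟨N₀, hN₀⟩, fun N hN =>
    ⟨fun l hl => ?_, hzero N hN, hinf N hN, horth N hN⟩⟩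
  rw [indicatorFourier_smul (by exact_mod_cast hN.1.ne'), smul_smul,
    show (N : ℝ) * (2 * Real.pi * (l : ℝ)) = 2 * Real.pi * (N : ℝ) * (l : ℝ) by ring,
    hzero N hN l hl, smul_zero]
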